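/- Theorem (Gaussian lower bound). Let $\tau\ge 1$, let $\|\cdot\|_{(1)},\dots,\|\cdot\|_{(\tau)}$ be norms on $\mathbb{R}^n$, let $\mathcal{C}\subseteq\mathbb{R}^n$ be a closed convex cone, and let $0\neq x_0\in\mathcal{C}$. Write $\bar x_0=x_0/\|x_0\|_2$, $$L_i=\sup_{z_1\neq z_2}\frac{\|z_1\|_{(i)}-\|z_2\|_{(i)}}{\|z_1-z_2\|_2},\qquad \kappa_i=\frac{\|\bar x_0\|_{(i)}}{L_i},\qquad \kappa_{\min}=\min_{1\le i\le\tau}\kappa_i,$$ and let $\bar D(\mathcal{C})=\frac{1}{\sqrt n}\,\mathbb{E}\big[\inf_{v\in\mathcal{C}}\|g-v\|_2\big]$, where $g\in\mathbb{R}^n$ has independent $\mathcal{N}(0,1)$ entries, be the normalized Gaussian distance of $\mathcal{C}$. Set $$m_{\rm low}=\frac{(1-\bar D(\mathcal{C}))\,n\,\kappa_{\min}^2}{100}.$$ Let $A\in\mathbb{R}^{m\times n}$ be a random matrix with independent $\mathcal{N}(0,1)$ entries. If $m\le m_{\rm low}$, then with probability at least $$1-10\exp\Big(-\tfrac1{16}\min\{m_{\rm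 low},\,(1-\bar D(\mathcal{C}))^2 n\}\Big)$$ the following holds simultaneously for all functions $h:\mathbb{R}_+^\tau\to\mathbb{R}_+$ that are convex, non-decreasing in each argument and, at every point of $\mathbb{R}_+^\tau$, strictly increasing in at least one coordinate (for every $v\in\mathbb{R}_+^\tau$ there is an $i$, possibly depending on $v$, such that raising the $i$-th coordinate of $v$ strictly increases $h$): the point $x_0$ is not a minimizer of the program $$\min_{x\in\mathcal{C}}\ h(\|x\|_{(1)},\dots,\|x\|_{(\tau)})\quad\text{subject to}\quad Ax=Ax_0 .$$ -/

import Mathlib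

open MeasureTheory ProbabilityTheory
open scoped BigOperators

noncomputable section

/-- The Lipschitz constant of a norm `p` on `ℝⁿ` with respect to the Euclidean norm,
`L = sup_{z₁ ≠ z₂} (p z₁ - p z₂) / ‖z₁ - z₂‖₂`. -/
def lipConst {n : ℕ} (p : Seminorm ℝ (EuclideanSpace ℝ (Fin n))) : ℝ :=
  sSup {r : ℝ | ∃ z₁ z₂ : EuclideanSpace ℝ (Fin n), z₁ ≠ z₂ ∧ r = (p z₁ - p z₂) / ‖z₁ - z₂‖}

/-- `κ = p(x̄) / L`, where `x̄ = x / ‖x‖₂` and `L` is the Lipschitz constant of `p`. -/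
def kappa {n : ℕ} (p : Seminorm ℝ (EuclideanSpace ℝ (Fin n)))
    (x : EuclideanSpace ℝ (Fin n)) : ℝ :=
  p (‖x‖⁻¹ • x) / lipConst p

/-- `κ_min`, the smallest of the numbers `κ_i` (used with `0 < τ`). -/
def kappaMin {n τ : ℕ} (N : Fin τ → Seminorm ℝ (EuclideanSpace ℝ (Fin n)))
    (x : EuclideanSpace ℝ (Fin n)) : ℝ :=
  ⨅ i, kappa (N i) x

/-- The Gaussian distance `D(M) = E[inf_{v ∈ M} ‖h - v‖₂]`, with `h` a standard Gaussian vector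
of `ℝⁿ`. -/
def gaussianDist {n : ℕ} (M : Set (EuclideanSpace ℝ (Fin n))) : ℝ :=
  ∫ h, Metric.infDist h M ∂(stdGaussian (EuclideanSpace ℝ (Fin n)))

/-- The normalized Gaussian distance `D(M) / √n`. -/
def normalizedGaussianDist {n : ℕ} (M : Set (EuclideanSpace ℝ (Fin n))) : ℝ :=
  gaussianDist M / √(n : ℝ)

/-- The threshold `m_low = (1 - D̄(C)) n κ_min² / 100`. -/
def mLow {n τ : ℕ} (N : Fin τ → Seminorm ℝ (EuclideanSpace ℝ (Fin n)))
    (C : Set (EuclideanSpace ℝ (Fin n))) (x₀ : EuclideanSpace ℝ (Fin n)) : ℝ :=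
  (1 - normalizedGaussianDist C) * n * kappaMin N x₀ ^ 2 / 100

/-- The admissible scalarizing functions `h : ℝ₊^τ → ℝ₊`: convex, non-decreasing in each argument,
and, at every point of the orthant, strictly increasing in at least one coordinate. The coordinate
may depend on the point, so that `h = max` is admissible, as is every `h` that is strictly
increasing in one fixed coordinate. Only the values of `h` on the orthant matter. -/
structure IsScalarization {τ : ℕ} (h : (Fin τ → ℝ) → ℝ) : Prop where
  nonneg : ∀ v ∈ Set.Ici (0 : Fin τ → ℝ), 0 ≤ h v
  convexOn : ConvexOn ℝ (Set.Ici (0 : Fin τ → ℝ)) h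
  monotoneOn : MonotoneOn h (Set.Ici (0 : Fin τ → ℝ))
  exists_strict : ∀ v ∈ Set.Ici (0 : Fin τ → ℝ), ∃ i, ∀ t, v i < t → h v < h (Function.update v i t)

/-- The feasible set `{x ∈ C : A x = A x₀}` of the recovery program. -/
def feasibleSet {m n : ℕ} (A : Matrix (Fin m) (Fin n) ℝ) (C : Set (EuclideanSpace ℝ (Fin n)))
    (x₀ : EuclideanSpace ℝ (Fin n)) : Set (EuclideanSpace ℝ (Fin n)) :=
  {x | x ∈ C ∧ A.mulVec x.ofLp = A.mulVec x₀.ofLp}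

/-- `x` is a minimizer of the program: minimize `h(‖y‖₍₁₎, …, ‖y‖₍τ₎)` over `y ∈ C` subject to
`A y = A x₀`. -/
def IsProgramMinimizer {m n τ : ℕ} (N : Fin τ → Seminorm ℝ (EuclideanSpace ℝ (Fin n)))
    (h : (Fin τ → ℝ) → ℝ) (A : Matrix (Fin m) (Fin n) ℝ) (C : Set (EuclideanSpace ℝ (Fin n)))
    (x₀ x : EuclideanSpace ℝ (Fin n)) : Prop :=
  x ∈ feasibleSet A C x₀ ∧ IsMinOn (fun y => h (fun i => N i y)) (feasibleSet A C x₀) x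

end

open scoped NNReal ENNReal

/-! It suffices to find `v ∈ C` with `A v = A x̄₀` and `‖v‖ < κ_min`: then `‖x₀‖ v` is feasible and
strictly smaller than `x₀` in every norm, so `x₀` is not optimal
(`not_isProgramMinimizer_of_norm_lt`).

Let `K` be the unit-ball part of `C`. By Hahn–Banach, `A(rK)` contains the ball of radius `rσ` once
`z ↦ sup_{v ∈ K} ⟪Aᵀz, v⟫` is at least `σ` on the unit sphere (`exists_mem_map_smul_eq`). For one
unit `z` the vector `Aᵀz` is standard Gaussian and the support function is 1-Lipschitz, so it
concentrates around its mean `W`; a net of at most `17^m` points makes this uniform in `z`. The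
polar decomposition of `ℝⁿ` along `C` gives `W² ≥ n - D(C)² - 32`, hence `W²` is at least about `(1
- D̄) n`. Since `‖A x̄₀‖` is at most about `√m`, of order `κ_min W` with a small constant, a radius
`r < κ_min` suffices. -/

/-! ### Absolute continuity, exponential moments and Jensen's inequality. -/

theorem pi_absolutelyContinuous : ∀ {n : ℕ} {μ ν : Fin n → Measure ℝ}
    [∀ i, SigmaFinite (μ i)] [∀ i, SigmaFinite (ν i)], (∀ i, μ i ≪ ν i) →
    Measure.pi μ ≪ Measure.pi ν := by
  intro n
  induction n with
  | zero =>
    intro μ ν _ _ _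
    rw [Measure.pi_of_empty μ, Measure.pi_of_empty ν]
  | succ n ih =>
    intro μ ν _ _ h
    have hμ := (measurePreserving_piFinSuccAbove μ 0).symm.map_eq
    have hν := (measurePreserving_piFinSuccAbove ν 0).symm.map_eq
    rw [← hμ, ← hν]
    exact ((h 0).prod (ih fun j => h _)).map (MeasurableEquiv.measurable _)

/-- Transfers Rademacher's almost-everywhere differentiability from Lebesgue to Gaussian measure. -/
theorem stdGaussian_absolutelyContinuous (n : ℕ) :
    stdGaussian (EuclideanSpace ℝ (Fin n)) ≪ volume := by
  rw [← map_pi_eq_stdGaussian, ← (PiLp.volume_preserving_toLp (Fin n)).map_eq]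
  exact (pi_absolutelyContinuous fun _ =>
    gaussianReal_absolutelyContinuous 0 one_ne_zero).map (by fun_prop)

section

variable {E : Type*} [NormedAddCommGroup E] [InnerProductSpace ℝ E] [FiniteDimensional ℝ E]
  [MeasurableSpace E] [BorelSpace E]

theorem lintegral_exp_dual_stdGaussian (L : StrongDual ℝ E) :
    ∫⁻ y, ENNReal.ofReal (Real.exp (L y)) ∂(stdGaussian E)
      = ENNReal.ofReal (Real.exp (‖L‖ ^ 2 / 2)) := by
  have hmap := IsGaussian.map_eq_gaussianReal (μ := stdGaussian E) L
  have hmgf := mgf_gaussianReal hmap 1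
  have hint : Integrable (fun y => Real.exp (L y)) (stdGaussian E) := by
    have := integrable_exp_mul_gaussianReal (μ := (stdGaussian E)[L])
      (v := Var[L; stdGaussian E].toNNReal) 1
    rw [← hmap, integrable_map_measure (by fun_prop) (by fun_prop)] at this
    simpa [Function.comp_def] using this
  rw [← ofReal_integral_eq_lintegral_ofReal hint (ae_of_all _ fun _ => (Real.exp_pos _).le)]
  congr 1
  rw [integral_strongDual_stdGaussian, variance_dual_stdGaussian] at hmgf
  simpa [mgf, Real.coe_toNNReal _ (sq_nonneg ‖L‖)] using hmgf

end

theorem ofReal_integral_le_lintegral_ofReal {α : Type*} [MeasurableSpace α] {μ : Measure α}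
    {f : α → ℝ} (hf : Integrable f μ) :
    ENNReal.ofReal (∫ x, f x ∂μ) ≤ ∫⁻ x, ENNReal.ofReal (f x) ∂μ := by
  calc ENNReal.ofReal (∫ x, f x ∂μ) ≤ ENNReal.ofReal (∫ x, max (f x) 0 ∂μ) :=
        ENNReal.ofReal_le_ofReal (integral_mono hf hf.pos_part fun x => le_max_left _ _)
    _ = ∫⁻ x, ENNReal.ofReal (max (f x) 0) ∂μ :=
        ofReal_integral_eq_lintegral_ofReal hf.pos_part (ae_of_all _ fun x => le_max_right _ _)
    _ = ∫⁻ x, ENNReal.ofReal (f x) ∂μ := by simp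

/-- Jensen's inequality for the exponential, without integrability of the exponential. -/
theorem ofReal_exp_integral_le {α : Type*} [MeasurableSpace α] {μ : Measure α}
    [IsProbabilityMeasure μ] {f : α → ℝ} (hf : Integrable f μ) :
    ENNReal.ofReal (Real.exp (∫ x, f x ∂μ)) ≤ ∫⁻ x, ENNReal.ofReal (Real.exp (f x)) ∂μ := by
  set I := ∫ x, f x ∂μ with hI
  have hg : Integrable (fun x => Real.exp I * (1 + (f x - I))) μ :=
    ((integrable_const _).add (hf.sub (integrable_const _))).const_mul _
  have hgI : ∫ x, Real.exp I * (1 + (f x - I)) ∂μ = Real.exp I := by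
    have h1 : ∫ x, (f x - I) ∂μ = I - I := by
      rw [integral_sub hf (integrable_const _)]; simp [← hI]
    have h2 : ∫ x, (1 + (f x - I)) ∂μ = 1 := by
      rw [integral_add (g := fun x => f x - I) (integrable_const _)
        (hf.sub (integrable_const _)), h1]
      simp
    rw [integral_const_mul, h2, mul_one]
  rw [← hgI]
  refine (ofReal_integral_le_lintegral_ofReal hg).trans (lintegral_mono fun x => ?_)
  refine ENNReal.ofReal_le_ofReal ?_
  have h1 := Real.add_one_le_exp (f x - I)
  calc Real.exp I * (1 + (f x - I)) ≤ Real.exp I * Real.exp (f x - I) := by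
        gcongr; linarith
    _ = Real.exp (f x) := by rw [← Real.exp_add]; congr 1; ring

/-! ### Gaussian concentration by the rotation argument of Maurey and Pisier. -/

section

variable {n : ℕ}

local notation "V" => EuclideanSpace ℝ (Fin n)
local notation "γ" => stdGaussian (EuclideanSpace ℝ (Fin n))

theorem measurable_rotation_uncurry :
    Measurable fun q : (V × V) × ℝ => ContinuousLinearMap.rotation q.2 q.1 := by
  simp only [ContinuousLinearMap.rotation_apply]
  fun_prop

theorem measurable_exp_fderiv (f : V → ℝ) (c : ℝ) :
    Measurable fun p : V × V => ENNReal.ofReal (Real.exp (c * fderiv ℝ f p.1 p.2)) := by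
  have h : Measurable fun p : V × V => fderiv ℝ f p.1 p.2 :=
    isBoundedBilinearMap_apply.continuous.measurable.comp
      (((measurable_fderiv ℝ f).comp measurable_fst).prodMk measurable_snd)
  fun_prop

/-- For each fixed angle, rotation preserves `γ ⊗ γ`, so the rotated first component has law `γ`;
Fubini then exchanges the quantifiers. -/
theorem ae_differentiableAt_rotation {f : V → ℝ} (hf : LipschitzWith 1 f)
    (ρ : Measure ℝ) [SFinite ρ] :
    ∀ᵐ p ∂((γ).prod γ), ∀ᵐ θ ∂ρ,
      DifferentiableAt ℝ f (ContinuousLinearMap.rotation θ p).1 := by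
  have hmeas : MeasurableSet {q : (V × V) × ℝ |
      DifferentiableAt ℝ f (ContinuousLinearMap.rotation q.2 q.1).1} :=
    (measurable_fst.comp measurable_rotation_uncurry) (measurableSet_of_differentiableAt ℝ f)
  have hd : ∀ᵐ x ∂(γ), DifferentiableAt ℝ f x :=
    (stdGaussian_absolutelyContinuous n).ae_le hf.ae_differentiableAt
  refine (Measure.ae_ae_comm (p := fun p θ =>
    DifferentiableAt ℝ f (ContinuousLinearMap.rotation θ p).1) hmeas).2 (ae_of_all _ fun θ => ?_)
  have hrot := IsGaussian.map_rotation_eq_self (μ := γ) (by simp [id]) θ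
  have h1 : ∀ᵐ p ∂((γ).prod γ), DifferentiableAt ℝ f p.1 :=
    Measure.quasiMeasurePreserving_fst.ae hd
  rw [← hrot] at h1
  exact ae_of_ae_map (ContinuousLinearMap.rotation θ).continuous.aemeasurable h1

theorem hasDerivAt_rotation_fst (p : V × V) (θ : ℝ) :
    HasDerivAt (fun t => (ContinuousLinearMap.rotation t p).1)
      (ContinuousLinearMap.rotation θ p).2 θ := by
  simp only [ContinuousLinearMap.rotation_apply]
  exact ((Real.hasDerivAt_cos θ).smul_const p.1).add ((Real.hasDerivAt_sin θ).smul_const p.2)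

theorem norm_rotation_snd_le (p : V × V) (θ : ℝ) :
    ‖(ContinuousLinearMap.rotation θ p).2‖ ≤ ‖p.1‖ + ‖p.2‖ := by
  simp only [ContinuousLinearMap.rotation_apply]
  refine (norm_add_le _ _).trans (add_le_add ?_ ?_)
  · rw [norm_smul, norm_neg]
    exact mul_le_of_le_one_left (norm_nonneg _) (Real.abs_sin_le_one θ)
  · rw [norm_smul]
    exact mul_le_of_le_one_left (norm_nonneg _) (Real.abs_cos_le_one θ)

theorem lipschitzWith_comp_rotation {f : V → ℝ} (hf : LipschitzWith 1 f) (p : V × V) :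
    LipschitzWith (‖p.1‖₊ + ‖p.2‖₊) fun θ => f (ContinuousLinearMap.rotation θ p).1 := by
  have h : LipschitzWith (‖p.1‖₊ + ‖p.2‖₊)
      fun θ : ℝ => (ContinuousLinearMap.rotation θ p).1 := by
    refine lipschitzWith_of_nnnorm_deriv_le
      (fun θ => (hasDerivAt_rotation_fst p θ).differentiableAt) fun θ => ?_
    rw [(hasDerivAt_rotation_fst p θ).deriv]
    exact_mod_cast norm_rotation_snd_le p θ
  simpa only [one_mul] using! hf.comp h

/-- The uniform distribution on `(0, π / 2]`. -/
noncomputable def uniformQuarter : Measure ℝ :=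
  ENNReal.ofReal (2 / Real.pi) • volume.restrict (Set.Ioc 0 (Real.pi / 2))

instance : IsProbabilityMeasure uniformQuarter := by
  refine ⟨?_⟩
  simp only [uniformQuarter, Measure.smul_apply, Measure.restrict_apply_univ, Real.volume_Ioc,
    smul_eq_mul]
  rw [← ENNReal.ofReal_mul (by positivity)]
  have := Real.pi_pos
  have h : 2 / Real.pi * (Real.pi / 2 - 0) = 1 := by field_simp; ring
  rw [h, ENNReal.ofReal_one]

/-- The rotation path runs from `p.1` to `p.2` over an angle `π / 2`. The difference of values is
the integral of the derivative along it, which Jensen turns into an average of exponentials. -/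
theorem exp_sub_le_lintegral_rotation {f : V → ℝ} (hf : LipschitzWith 1 f) (t : ℝ) (p : V × V)
    (hp : ∀ᵐ θ ∂uniformQuarter, DifferentiableAt ℝ f (ContinuousLinearMap.rotation θ p).1) :
    ENNReal.ofReal (Real.exp (t * (f p.2 - f p.1))) ≤
      ∫⁻ θ, ENNReal.ofReal (Real.exp (t * (Real.pi / 2) *
        fderiv ℝ f (ContinuousLinearMap.rotation θ p).1 (ContinuousLinearMap.rotation θ p).2))
        ∂uniformQuarter := by
  set g : ℝ → ℝ := fun θ => f (ContinuousLinearMap.rotation θ p).1 with hg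
  have hgL := lipschitzWith_comp_rotation hf p
  have hac : AbsolutelyContinuousOnInterval g 0 (Real.pi / 2) :=
    (hgL.lipschitzOnWith (s := Set.uIcc 0 (Real.pi / 2))).absolutelyContinuousOnInterval
  have hftc := hac.integral_deriv_eq_sub
  have hpi := Real.pi_pos
  have hint : Integrable (fun θ => t * (Real.pi / 2) * deriv g θ) uniformQuarter := by
    have h1 := hac.intervalIntegrable_deriv
    rw [intervalIntegrable_iff_integrableOn_Ioc_of_le (by positivity)] at h1
    exact (Integrable.smul_measure h1 ENNReal.ofReal_ne_top).const_mul _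
  have hI : ∫ θ, t * (Real.pi / 2) * deriv g θ ∂uniformQuarter = t * (f p.2 - f p.1) := by
    rw [integral_const_mul, uniformQuarter, integral_smul_measure,
      ← intervalIntegral.integral_of_le (by positivity), hftc,
      ENNReal.toReal_ofReal (by positivity)]
    simp only [hg, ContinuousLinearMap.rotation_apply, Real.cos_pi_div_two, Real.sin_pi_div_two,
      Real.cos_zero, Real.sin_zero, zero_smul, one_smul, zero_add, add_zero, smul_eq_mul]
    field_simp
  rw [← hI]
  refine (ofReal_exp_integral_le hint).trans (le_of_eq (lintegral_congr_ae ?_))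
  filter_upwards [hp] with θ hθ
  have h2 : HasDerivAt g (fderiv ℝ f (ContinuousLinearMap.rotation θ p).1
      (ContinuousLinearMap.rotation θ p).2) θ :=
    hθ.hasFDerivAt.comp_hasDerivAt θ (hasDerivAt_rotation_fst p θ)
  rw [h2.deriv]

/-- With the first component frozen, the derivative is a linear form of norm at most 1 evaluated at
an independent Gaussian. Where `f` is not differentiable, `fderiv` is 0 and the bound persists. -/
theorem lintegral_exp_fderiv_le {f : V → ℝ} (hf : LipschitzWith 1 f) (c : ℝ) :
    ∫⁻ p, ENNReal.ofReal (Real.exp (c * fderiv ℝ f p.1 p.2)) ∂((γ).prod γ)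
      ≤ ENNReal.ofReal (Real.exp (c ^ 2 / 2)) := by
  rw [lintegral_prod _ (measurable_exp_fderiv f c).aemeasurable]
  calc _ ≤ ∫⁻ _, ENNReal.ofReal (Real.exp (c ^ 2 / 2)) ∂(γ) := by
        refine lintegral_mono fun x => ?_
        have h := lintegral_exp_dual_stdGaussian (c • fderiv ℝ f x)
        simp only [smul_apply, smul_eq_mul] at h
        refine h.le.trans (ENNReal.ofReal_le_ofReal (Real.exp_le_exp.2 ?_))
        have h1 : ‖fderiv ℝ f x‖ ≤ 1 := by
          simpa using norm_fderiv_le_of_lipschitz ℝ (x₀ := x) hf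
        rw [norm_smul, mul_pow, Real.norm_eq_abs, sq_abs]
        have h2 : ‖fderiv ℝ f x‖ ^ 2 ≤ 1 := pow_le_one₀ (norm_nonneg _) h1
        nlinarith [sq_nonneg c]
    _ = _ := by simp

theorem lintegral_exp_sub_le {f : V → ℝ} (hf : LipschitzWith 1 f) (t : ℝ) :
    ∫⁻ p, ENNReal.ofReal (Real.exp (t * (f p.2 - f p.1))) ∂((γ).prod γ)
      ≤ ENNReal.ofReal (Real.exp ((5 / 2) * t ^ 2 / 2)) := by
  set K : V × V → ℝ≥0∞ := fun p =>
    ENNReal.ofReal (Real.exp (t * (Real.pi / 2) * fderiv ℝ f p.1 p.2)) with hK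
  have hKm : Measurable K := measurable_exp_fderiv f _
  calc _ ≤ ∫⁻ p, ∫⁻ θ, K (ContinuousLinearMap.rotation θ p) ∂uniformQuarter ∂((γ).prod γ) := by
        refine lintegral_mono_ae ?_
        filter_upwards [ae_differentiableAt_rotation hf uniformQuarter] with p hp
        exact exp_sub_le_lintegral_rotation hf t p hp
    _ = ∫⁻ θ, ∫⁻ p, K (ContinuousLinearMap.rotation θ p) ∂((γ).prod γ) ∂uniformQuarter :=
        lintegral_lintegral_swap (hKm.comp measurable_rotation_uncurry).aemeasurable
    _ = ∫⁻ θ, ∫⁻ p, K p ∂((γ).prod γ) ∂uniformQuarter := by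
        refine lintegral_congr fun θ => ?_
        rw [← lintegral_map hKm (by fun_prop),
          IsGaussian.map_rotation_eq_self (μ := γ) (by simp [id]) θ]
    _ = ∫⁻ p, K p ∂((γ).prod γ) := by simp
    _ ≤ _ := by
        refine (lintegral_exp_fderiv_le hf _).trans
          (ENNReal.ofReal_le_ofReal (Real.exp_le_exp.2 ?_))
        -- The variance proxy is `(π / 2)²`, which is at most `5 / 2`.
        have h1 : Real.pi ^ 2 ≤ 10 := by nlinarith [Real.pi_lt_d2, Real.pi_pos]
        nlinarith [sq_nonneg t]

theorem LipschitzWith.memLp_two_stdGaussian {f : V → ℝ} (hf : LipschitzWith 1 f) :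
    MemLp f 2 γ := by
  have h1 : MemLp (fun x : V => ‖x‖ + |f 0|) 2 γ :=
    (IsGaussian.memLp_two_id (μ := γ)).norm.add (memLp_const _)
  refine h1.mono hf.continuous.aestronglyMeasurable (ae_of_all _ fun x => ?_)
  have h2 := hf.dist_le_mul x 0
  rw [dist_zero_right, Real.dist_eq, NNReal.coe_one, one_mul] at h2
  rw [Real.norm_eq_abs, Real.norm_eq_abs, abs_of_nonneg (a := ‖x‖ + |f 0|) (by positivity)]
  calc |f x| = |(f x - f 0) + f 0| := by ring_nf
    _ ≤ |f x - f 0| + |f 0| := abs_add_le _ _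
    _ ≤ _ := by gcongr

theorem LipschitzWith.integrable_stdGaussian {f : V → ℝ} (hf : LipschitzWith 1 f) :
    Integrable f γ :=
  hf.memLp_two_stdGaussian.integrable one_le_two

/-- Gaussian concentration for Lipschitz functions (with a non-optimal constant). -/
theorem LipschitzWith.hasSubgaussianMGF_stdGaussian {f : V → ℝ} (hf : LipschitzWith 1 f) :
    HasSubgaussianMGF (fun x => f x - ∫ y, f y ∂(γ)) (5 / 2) γ := by
  have hfi := hf.integrable_stdGaussian
  have hfc := hf.continuous
  have key : ∀ t : ℝ, ∫⁻ x, ENNReal.ofReal (Real.exp (t * (f x - ∫ y, f y ∂(γ)))) ∂(γ)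
      ≤ ENNReal.ofReal (Real.exp ((5 / 2) * t ^ 2 / 2)) := by
    intro t
    -- With parameter `-t` the exponent is `t (f x - f y)`; Jensen in the independent copy `y` then
    -- replaces `f y` by its mean.
    have h1 := lintegral_exp_sub_le hf (-t)
    rw [lintegral_prod _ (by fun_prop), neg_sq] at h1
    refine (lintegral_mono fun x => ?_).trans h1
    have h2 := ofReal_exp_integral_le (μ := γ) (f := fun y => -t * (f y - f x))
      ((hfi.sub (integrable_const _)).const_mul _)
    refine le_of_eq_of_le ?_ h2
    rw [integral_const_mul, integral_sub hfi (integrable_const _)]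
    congr 2
    simp
    ring
  have hint : ∀ t : ℝ, Integrable (fun x => Real.exp (t * (f x - ∫ y, f y ∂(γ)))) γ := by
    intro t
    refine (lintegral_ofReal_ne_top_iff_integrable (by fun_prop)
      (ae_of_all _ fun _ => (Real.exp_pos _).le)).1 ?_
    exact ((key t).trans_lt ENNReal.ofReal_lt_top).ne
  refine ⟨hint, fun t => ?_⟩
  have h1 := key t
  rw [← ofReal_integral_eq_lintegral_ofReal (hint t) (ae_of_all _ fun _ => (Real.exp_pos _).le),
    ENNReal.ofReal_le_ofReal_iff (Real.exp_pos _).le] at h1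
  simpa [mgf] using h1

theorem LipschitzWith.measure_add_le {f : V → ℝ} (hf : LipschitzWith 1 f) {s : ℝ} (hs : 0 ≤ s) :
    (γ).real {x | (∫ y, f y ∂(γ)) + s ≤ f x} ≤ Real.exp (-s ^ 2 / 5) := by
  have h := hf.hasSubgaussianMGF_stdGaussian.measure_ge_le hs
  have e : {x : V | (∫ y, f y ∂(γ)) + s ≤ f x} = {x | s ≤ f x - ∫ y, f y ∂(γ)} := by
    ext x; simp only [Set.mem_ofPred_eq]; constructor <;> intro h <;> linarith
  rw [e]
  refine h.trans (le_of_eq ?_)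
  congr 2
  norm_num

theorem LipschitzWith.measure_le_sub {f : V → ℝ} (hf : LipschitzWith 1 f) {s : ℝ} (hs : 0 ≤ s) :
    (γ).real {x | f x ≤ (∫ y, f y ∂(γ)) - s} ≤ Real.exp (-s ^ 2 / 5) := by
  have h := hf.neg.measure_add_le hs
  have e : {x : V | f x ≤ (∫ y, f y ∂(γ)) - s}
      = {x | (∫ y, (-f) y ∂(γ)) + s ≤ (-f) x} := by
    ext x
    simp only [Set.mem_ofPred_eq, Pi.neg_apply, integral_neg]
    constructor <;> intro h <;> linarith
  rwa [e]

/-- The variance is bounded through `u² ≤ 2 (eᵘ + e⁻ᵘ)` and the exponential moments at `±1`, each at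
most `e^(5/4) ≤ 4`; hence `16 = 2 (4 + 4)`. -/
theorem LipschitzWith.integral_sq_le {f : V → ℝ} (hf : LipschitzWith 1 f) :
    ∫ x, f x ^ 2 ∂(γ) ≤ (∫ x, f x ∂(γ)) ^ 2 + 16 := by
  set I := ∫ x, f x ∂(γ) with hI
  have hfi := hf.integrable_stdGaussian
  have hsub := hf.hasSubgaussianMGF_stdGaussian
  have h2 : ∫ x, (f x - I) ^ 2 ∂(γ) ≤ 16 := by
    have i1 := hsub.integrable_exp_mul 1
    have i2 := hsub.integrable_exp_mul (-1)
    have m1 := hsub.mgf_le 1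
    have m2 := hsub.mgf_le (-1)
    simp only [mgf] at m1 m2
    have hle : ∫ x, (f x - I) ^ 2 ∂(γ) ≤
        ∫ x, 2 * (Real.exp (1 * (f x - I)) + Real.exp (-1 * (f x - I))) ∂(γ) := by
      refine integral_mono (hf.memLp_two_stdGaussian.sub (memLp_const I)).integrable_sq
        ((i1.add i2).const_mul 2) fun x => ?_
      have hq : ∀ u : ℝ, u ^ 2 ≤ 2 * (Real.exp u + Real.exp (-u)) := by
        intro u
        rcases le_total 0 u with hu | hu
        · have := Real.quadratic_le_exp_of_nonneg hu
          have := Real.exp_pos (-u)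
          linarith
        · have := Real.quadratic_le_exp_of_nonneg (neg_nonneg.2 hu)
          have := Real.exp_pos u
          rw [neg_sq] at *
          linarith
      have := hq (f x - I)
      simpa using this
    rw [integral_const_mul, integral_add i1 i2] at hle
    have he : Real.exp (((5 / 2 : ℝ≥0) : ℝ) * 1 ^ 2 / 2) ≤ 4 := by
      have h1 : (((5 / 2 : ℝ≥0) : ℝ) * 1 ^ 2 / 2) = 5 / 4 := by push_cast; norm_num
      rw [h1]
      have h4 := Real.exp_one_lt_d9
      have h5 : Real.exp (5 / 4 : ℝ) = Real.exp (1 / 4) ^ 5 := by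
        rw [← Real.exp_nat_mul]; norm_num
      have h6 : Real.exp (1 : ℝ) = Real.exp (1 / 4) ^ 4 := by
        rw [← Real.exp_nat_mul]; norm_num
      have h7 : 0 < Real.exp (1 / 4 : ℝ) := Real.exp_pos _
      have h8 : Real.exp (1 / 4 : ℝ) ≤ 1.2841 := by
        by_contra hcon
        push Not at hcon
        have : (1.2841 : ℝ) ^ 4 ≤ Real.exp (1 / 4) ^ 4 := by gcongr
        rw [← h6] at this
        norm_num at this h4
        linarith
      rw [h5, pow_succ, ← h6]
      nlinarith
    have he' : Real.exp (((5 / 2 : ℝ≥0) : ℝ) * (-1) ^ 2 / 2) ≤ 4 := by simpa using he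
    linarith
  have h3 : ∫ x, (f x - I) ^ 2 ∂(γ) = ∫ x, f x ^ 2 ∂(γ) - I ^ 2 := by
    have i3 := hf.memLp_two_stdGaussian.integrable_sq
    have h4 : ∫ x, (f x - I) ^ 2 ∂(γ) = ∫ x, (f x ^ 2 - 2 * I * f x + I ^ 2) ∂(γ) := by
      congr 1; ext x; ring
    rw [h4, integral_add (f := fun x => f x ^ 2 - 2 * I * f x) (i3.sub (hfi.const_mul _))
      (integrable_const _), integral_sub i3 (hfi.const_mul _), integral_const_mul]
    simp [← hI]
    ring
  linarith

end

/-! ### Support functions, surjectivity by separation, and projection onto a cone. -/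

section

variable {E F : Type*} [NormedAddCommGroup E] [InnerProductSpace ℝ E]
  [NormedAddCommGroup F] [InnerProductSpace ℝ F]

/-- The support function `x ↦ sup_{v ∈ K} ⟪x, v⟫` of a set `K`. -/
noncomputable def supportFun (K : Set E) (x : E) : ℝ := sSup ((fun v => inner ℝ x v) '' K)

theorem inner_le_norm_of_subset {K : Set E} (hK : K ⊆ Metric.closedBall 0 1) (x : E) {v : E}
    (hv : v ∈ K) : inner ℝ x v ≤ ‖x‖ :=
  (real_inner_le_norm x v).trans
    (mul_le_of_le_one_right (norm_nonneg _) (by simpa using hK hv))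

theorem inner_le_supportFun {K : Set E} (hK : K ⊆ Metric.closedBall 0 1) (x : E) {v : E}
    (hv : v ∈ K) : inner ℝ x v ≤ supportFun K x := by
  refine le_csSup ⟨‖x‖, ?_⟩ (Set.mem_image_of_mem _ hv)
  rintro _ ⟨w, hw, rfl⟩
  exact inner_le_norm_of_subset hK x hw

theorem supportFun_le {K : Set E} (h0 : K.Nonempty) {x : E} {c : ℝ}
    (h : ∀ v ∈ K, inner ℝ x v ≤ c) : supportFun K x ≤ c := by
  refine csSup_le (h0.image _) ?_
  rintro _ ⟨w, hw, rfl⟩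
  exact h w hw

theorem supportFun_le_norm {K : Set E} (hK : K ⊆ Metric.closedBall 0 1) (h0 : K.Nonempty) (x : E) :
    supportFun K x ≤ ‖x‖ :=
  supportFun_le h0 fun _ hv => inner_le_norm_of_subset hK x hv

theorem supportFun_add_le {K : Set E} (hK : K ⊆ Metric.closedBall 0 1) (h0 : K.Nonempty) (x y : E) :
    supportFun K (x + y) ≤ supportFun K x + supportFun K y := by
  refine supportFun_le h0 fun v hv => ?_
  rw [inner_add_left]
  exact add_le_add (inner_le_supportFun hK x hv) (inner_le_supportFun hK y hv)

theorem supportFun_smul_le {K : Set E} (hK : K ⊆ Metric.closedBall 0 1) (h0 : K.Nonempty)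
    {c : ℝ} (hc : 0 ≤ c) (x : E) : supportFun K (c • x) ≤ c * supportFun K x := by
  refine supportFun_le h0 fun v hv => ?_
  rw [real_inner_smul_left]
  exact mul_le_mul_of_nonneg_left (inner_le_supportFun hK x hv) hc

theorem lipschitzWith_supportFun {K : Set E} (hK : K ⊆ Metric.closedBall 0 1) (h0 : K.Nonempty) :
    LipschitzWith 1 (supportFun K) := by
  refine LipschitzWith.of_le_add fun x y => ?_
  have h := supportFun_add_le hK h0 y (x - y)
  rw [add_sub_cancel] at h
  rw [dist_eq_norm]
  exact h.trans (add_le_add_right (supportFun_le_norm hK h0 _) _)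

/-- A lower bound for a support function on the unit sphere from two-sided bounds on a net. -/
theorem sub_div_le_supportFun_of_net [FiniteDimensional ℝ F] {K : Set E}
    (hK : K ⊆ Metric.closedBall 0 1) (h0 : K.Nonempty)
    (T : F →ₗ[ℝ] E) {s : Finset F} (hs : ∀ z : F, ‖z‖ = 1 → ∃ w ∈ s, ‖z - w‖ ≤ 1 / 8) {a b : ℝ}
    (hb0 : 0 ≤ b) (ha : ∀ w ∈ s, a ≤ supportFun K (T w)) (hb : ∀ w ∈ s, supportFun K (T w) ≤ b)
    {z : F} (hz : ‖z‖ = 1) : a - b / 7 ≤ supportFun K (T z) := by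
  have hcont : Continuous fun z => supportFun K (T z) :=
    (lipschitzWith_supportFun hK h0).continuous.comp T.continuous_of_finiteDimensional
  obtain ⟨z', hz', hmax⟩ := (isCompact_sphere (0 : F) 1).exists_isMaxOn
    ⟨z, by simpa using hz⟩ hcont.continuousOn
  set M := supportFun K (T z') with hM
  have hbd : ∀ d : F, supportFun K (T d) ≤ ‖d‖ * M := by
    intro d
    rcases eq_or_ne d 0 with rfl | hd
    · have := supportFun_le_norm hK h0 (T 0)
      simpa using this
    · have hn : ‖d‖ ≠ 0 := norm_ne_zero_iff.2 hd
      have h1 : supportFun K (T (‖d‖⁻¹ • d)) ≤ M :=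
        hmax (by simp [norm_smul, hn])
      have h2 := supportFun_smul_le hK h0 (norm_nonneg d) (T (‖d‖⁻¹ • d))
      rw [← map_smul, smul_smul, mul_inv_cancel₀ hn, one_smul] at h2
      exact h2.trans (mul_le_mul_of_nonneg_left h1 (norm_nonneg _))
  have hstep : ∀ d e : F, supportFun K (T d) ≤ supportFun K (T e) + ‖d - e‖ * M := by
    intro d e
    have h := supportFun_add_le hK h0 (T e) (T (d - e))
    rw [← map_add, add_sub_cancel] at h
    linarith [hbd (d - e)]
  -- A net point near the maximizer gives `M ≤ b + M / 8`.
  have hM7 : M ≤ 8 / 7 * b := by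
    obtain ⟨w, hw, hwz⟩ := hs z' (by simpa using hz')
    have h1 := hstep z' w
    have h2 := hb w hw
    rcases le_total 0 M with h | h
    · nlinarith
    · linarith
  obtain ⟨w, hw, hwz⟩ := hs z hz
  have h1 := hstep w z
  have h2 := ha w hw
  rw [norm_sub_rev] at h1
  have h3 : ‖z - w‖ * M ≤ b / 7 := by
    calc ‖z - w‖ * M ≤ ‖z - w‖ * (8 / 7 * b) := by gcongr
      _ ≤ 1 / 8 * (8 / 7 * b) := by gcongr
      _ = b / 7 := by ring
  linarith

/-- If the support function of the image of `K` is at least `σ` on the unit sphere, the image of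
`r K` contains the ball of radius `r σ`. -/
theorem exists_mem_map_smul_eq [FiniteDimensional ℝ E] [FiniteDimensional ℝ F] {K : Set E}
    (hKc : IsCompact K) (hKconv : Convex ℝ K) (h0 : K.Nonempty)
    (S : E →ₗ[ℝ] F) (T : F →ₗ[ℝ] E) (hadj : ∀ z v, inner ℝ (T z) v = inner ℝ z (S v))
    {σ r : ℝ} (hr : 0 ≤ r) (hσ : ∀ z : F, ‖z‖ = 1 → σ ≤ supportFun K (T z))
    {y : F} (hy : ‖y‖ ≤ r * σ) : ∃ v ∈ K, S (r • v) = y := by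
  by_contra hcon
  have hScont : Continuous fun v => S (r • v) :=
    S.continuous_of_finiteDimensional.comp (continuous_const_smul r)
  have himg : (fun v => S (r • v)) '' K = (r • S) '' K := by
    ext; simp
  have hclosed : IsClosed ((fun v => S (r • v)) '' K) := (hKc.image hScont).isClosed
  have hconv : Convex ℝ ((fun v => S (r • v)) '' K) := by
    rw [himg]; exact hKconv.linear_image _
  -- A functional `z` separating `y` from the image would give `r · supportFun K (T z) ≤ u < ⟪z, y⟫
  -- ≤ ‖z‖ r σ`, contradicting the lower bound by homogeneity.
  obtain ⟨f, u, hfu, huf⟩ := geometric_hahn_banach_closed_point hconv hclosed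
    (x := y) (by rintro ⟨v, hv, rfl⟩; exact hcon ⟨v, hv, rfl⟩)
  set z := (InnerProductSpace.toDual ℝ F).symm f with hz
  have hfz : ∀ w, f w = inner ℝ z w := fun w => by simp [hz]
  have hsup : r * supportFun K (T z) ≤ u := by
    rcases hr.eq_or_lt with rfl | hr
    · obtain ⟨v, hv⟩ := h0
      have := hfu _ (Set.mem_image_of_mem _ hv)
      simp at this
      simpa using this.le
    · rw [mul_comm, ← le_div_iff₀ hr]
      refine supportFun_le h0 fun v hv => ?_
      rw [le_div_iff₀ hr, hadj]
      have := hfu _ (Set.mem_image_of_mem _ hv)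
      simp only [hfz, map_smul, real_inner_smul_right] at this
      linarith
  have hz0 : z ≠ 0 := by
    intro hz0
    obtain ⟨v, hv⟩ := h0
    have h1 := hfu _ (Set.mem_image_of_mem _ hv)
    rw [hfz, hz0, inner_zero_left] at h1 huf
    linarith
  have hn : 0 < ‖z‖ := norm_pos_iff.2 hz0
  have hbdd : BddAbove ((fun v => inner ℝ (T z) v) '' K) :=
    (hKc.image (by fun_prop : Continuous fun v => inner ℝ (T z) v)).bddAbove
  have h1 : σ ≤ ‖z‖⁻¹ * supportFun K (T z) := by
    refine (hσ (‖z‖⁻¹ • z) (by simp [norm_smul, hn.ne'])).trans (supportFun_le h0 fun v hv => ?_)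
    rw [map_smul, real_inner_smul_left]
    exact mul_le_mul_of_nonneg_left (le_csSup hbdd (Set.mem_image_of_mem _ hv)) (by positivity)
  have h2 : ‖z‖ * σ ≤ supportFun K (T z) := by
    rw [inv_mul_eq_div, le_div_iff₀ hn] at h1
    linarith
  have h3 : inner ℝ z y ≤ ‖z‖ * ‖y‖ := real_inner_le_norm z y
  rw [hfz] at huf
  have h4 : ‖z‖ * ‖y‖ ≤ ‖z‖ * (r * σ) := by gcongr
  have h5 : r * (‖z‖ * σ) ≤ r * supportFun K (T z) := by gcongr
  nlinarith

theorem ConvexCone.zero_mem_of_isClosed {C : ConvexCone ℝ E} (hC : IsClosed (C : Set E)) {x : E}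
    (hx : x ∈ C) : (0 : E) ∈ C := by
  have h : Filter.Tendsto (fun t : ℝ => t • x) (nhdsWithin 0 (Set.Ioi 0)) (nhds ((0 : ℝ) • x)) :=
    ((continuous_id.smul continuous_const).tendsto 0).mono_left nhdsWithin_le_nhds
  rw [zero_smul] at h
  refine hC.mem_of_tendsto h ?_
  filter_upwards [self_mem_nhdsWithin] with t ht
  exact C.smul_mem ht hx

/-- Half of the Pythagorean identity for the projection onto a closed convex cone. -/
theorem ConvexCone.norm_sq_le [FiniteDimensional ℝ E] {C : ConvexCone ℝ E}
    (hC : IsClosed (C : Set E)) (h0 : (0 : E) ∈ C) (x : E) :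
    ‖x‖ ^ 2 ≤ supportFun ((C : Set E) ∩ Metric.closedBall 0 1) x ^ 2
      + Metric.infDist x (C : Set E) ^ 2 := by
  obtain ⟨p, hp, hpd⟩ := hC.exists_infDist_eq_dist ⟨0, h0⟩ x
  set K := (C : Set E) ∩ Metric.closedBall 0 1
  have hK : K ⊆ Metric.closedBall 0 1 := Set.inter_subset_right
  rw [hpd, dist_eq_norm]
  -- The nearest point `p` is also optimal along its own ray; first-order optimality at `t = 1`
  -- yields `⟪x, p⟫ = ‖p‖²`.
  have hmin : ∀ t : ℝ, 0 < t → ‖x - p‖ ^ 2 ≤ ‖x - t • p‖ ^ 2 := by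
    intro t ht
    have h1 := Metric.infDist_le_dist_of_mem (x := x) (show t • p ∈ (C : Set E) from C.smul_mem ht hp)
    rw [hpd, dist_eq_norm, dist_eq_norm] at h1
    gcongr
  have hexp : ∀ t : ℝ, ‖x - t • p‖ ^ 2 = ‖x‖ ^ 2 - 2 * t * inner ℝ x p + t ^ 2 * ‖p‖ ^ 2 := by
    intro t
    rw [norm_sub_sq_real, real_inner_smul_right, norm_smul, mul_pow, Real.norm_eq_abs, sq_abs]
    ring
  have h1 : ‖x - p‖ ^ 2 = ‖x‖ ^ 2 - 2 * inner ℝ x p + ‖p‖ ^ 2 := by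
    have := hexp 1; simpa using this
  have hort : inner ℝ x p = ‖p‖ ^ 2 := by
    have hq : ∀ t : ℝ, 0 < t →
        0 ≤ (t - 1) * ((t + 1) * ‖p‖ ^ 2 - 2 * inner ℝ x p) := by
      intro t ht
      have := hmin t ht
      rw [hexp, h1] at this
      linarith
    refine le_antisymm ?_ ?_
    · by_contra hlt
      push Not at hlt
      have hP := sq_nonneg ‖p‖
      set P := ‖p‖ ^ 2
      set I : ℝ := inner ℝ x p
      have hpos : 0 < (I - P) / (P + 1) := div_pos (by linarith) (by linarith)
      have := hq (1 + (I - P) / (P + 1)) (by linarith)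
      have h3 : (I - P) / (P + 1) * P ≤ I - P := by
        rw [div_mul_eq_mul_div, div_le_iff₀ (by linarith)]
        nlinarith
      have h4 : (1 + (I - P) / (P + 1) + 1) * P - 2 * I < 0 := by nlinarith
      nlinarith
    · by_contra hlt
      push Not at hlt
      have hP := sq_nonneg ‖p‖
      set P := ‖p‖ ^ 2
      set I : ℝ := inner ℝ x p
      have hpos : 0 < min (1 / 2) ((P - I) / (P + 1)) :=
        lt_min (by norm_num) (div_pos (by linarith) (by linarith))
      set e := min (1 / 2) ((P - I) / (P + 1)) with he
      have he1 : e ≤ 1 / 2 := min_le_left _ _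
      have he2 : e ≤ (P - I) / (P + 1) := min_le_right _ _
      rw [le_div_iff₀ (by linarith)] at he2
      have := hq (1 - e) (by linarith)
      have h4 : 0 < (1 - e + 1) * P - 2 * I := by nlinarith
      nlinarith
  have hsup : ‖p‖ ≤ supportFun K x := by
    rcases eq_or_ne p 0 with rfl | hp0
    · have := inner_le_supportFun hK x (v := 0) ⟨h0, by simp⟩
      simpa using this
    · have hn : 0 < ‖p‖ := norm_pos_iff.2 hp0
      have := inner_le_supportFun hK x (v := ‖p‖⁻¹ • p)
        ⟨C.smul_mem (by positivity) hp, by simp [norm_smul, hn.ne']⟩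
      rw [real_inner_smul_right, hort] at this
      calc ‖p‖ = ‖p‖⁻¹ * ‖p‖ ^ 2 := by field_simp
        _ ≤ _ := this
  have : ‖p‖ ^ 2 ≤ supportFun K x ^ 2 := by gcongr
  linarith

end

/-! ### Nets on the unit sphere. -/

/-- Volume comparison: balls of radius `1/16` around the points are disjoint and lie in a ball of
radius `17/16`. -/
theorem card_le_of_separated_closedBall {E : Type*} [NormedAddCommGroup E] [NormedSpace ℝ E]
    [FiniteDimensional ℝ E] (s : Finset E) (hs : ∀ c ∈ s, ‖c‖ ≤ 1)
    (h : ∀ c ∈ s, ∀ d ∈ s, c ≠ d → 1 / 8 ≤ ‖c - d‖) :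
    s.card ≤ 17 ^ Module.finrank ℝ E := by
  borelize E
  let μ : Measure E := Measure.addHaar
  have D : Set.Pairwise (s : Set E)
      (Function.onFun Disjoint fun c => Metric.ball (c : E) (1 / 16)) := by
    rintro c hc d hd hcd
    apply Metric.ball_disjoint_ball
    rw [dist_eq_norm]
    exact le_trans (by norm_num) (h c hc d hd hcd)
  have A_subset : (⋃ c ∈ s, Metric.ball (c : E) (1 / 16)) ⊆ Metric.ball (0 : E) (17 / 16) := by
    refine Set.iUnion₂_subset fun x hx => Metric.ball_subset_ball' ?_
    rw [dist_zero_right]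
    linarith [hs x hx]
  have I : (s.card : ℝ≥0∞) * ENNReal.ofReal ((1 / 16) ^ Module.finrank ℝ E) * μ (Metric.ball 0 1) ≤
      ENNReal.ofReal ((17 / 16) ^ Module.finrank ℝ E) * μ (Metric.ball 0 1) := by
    calc _ = μ (⋃ c ∈ s, Metric.ball (c : E) (1 / 16)) := by
          rw [measure_biUnion_finset D fun c _ => measurableSet_ball]
          simp only [μ.addHaar_ball_of_pos _ (show (0 : ℝ) < 1 / 16 by norm_num)]
          simp only [Finset.sum_const, nsmul_eq_mul, mul_assoc]
      _ ≤ μ (Metric.ball (0 : E) (17 / 16)) := measure_mono A_subset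
      _ = _ := by simp only [μ.addHaar_ball_of_pos _ (show (0 : ℝ) < 17 / 16 by norm_num)]
  have J : (s.card : ℝ≥0∞) * ENNReal.ofReal ((1 / 16) ^ Module.finrank ℝ E) ≤
      ENNReal.ofReal ((17 / 16) ^ Module.finrank ℝ E) :=
    (ENNReal.mul_le_mul_iff_left (Metric.measure_ball_pos _ _ zero_lt_one).ne'
      measure_ball_lt_top.ne).1 I
  have K : (s.card : ℝ) ≤ (17 : ℝ) ^ Module.finrank ℝ E := by
    have := ENNReal.toReal_le_of_le_ofReal (by positivity) J
    simpa [div_eq_mul_inv, mul_pow] using this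
  exact mod_cast K

/-- A `1/8`-separated subset of the sphere of maximal cardinality is a net, since any uncovered
point could be added. -/
theorem exists_net_sphere (E : Type*) [NormedAddCommGroup E] [NormedSpace ℝ E]
    [FiniteDimensional ℝ E] :
    ∃ s : Finset E, (∀ c ∈ s, ‖c‖ = 1) ∧ s.card ≤ 17 ^ Module.finrank ℝ E ∧
      ∀ z : E, ‖z‖ = 1 → ∃ w ∈ s, ‖z - w‖ ≤ 1 / 8 := by
  classical
  let P : ℕ → Prop := fun k => ∃ s : Finset E, s.card = k ∧ (∀ c ∈ s, ‖c‖ = 1) ∧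
    ∀ c ∈ s, ∀ d ∈ s, c ≠ d → 1 / 8 ≤ ‖c - d‖
  have hP : ∀ k, P k → k ≤ 17 ^ Module.finrank ℝ E := by
    rintro _ ⟨s, rfl, h1, h2⟩
    exact card_le_of_separated_closedBall s (fun c hc => (h1 c hc).le) h2
  obtain ⟨s, hcard, h1, h2⟩ : P (Nat.findGreatest P (17 ^ Module.finrank ℝ E)) :=
    Nat.findGreatest_spec (Nat.zero_le _) ⟨∅, by simp⟩
  refine ⟨s, h1, card_le_of_separated_closedBall s (fun c hc => (h1 c hc).le) h2,
    fun z hz => ?_⟩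
  by_contra! hcon
  have hzs : z ∉ s := fun hzs => by
    have := hcon z hzs
    norm_num at this
  have hP' : P (s.card + 1) := by
    refine ⟨insert z s, Finset.card_insert_of_notMem hzs, ?_, ?_⟩
    · intro c hc
      rcases Finset.mem_insert.1 hc with rfl | hc
      exacts [hz, h1 c hc]
    · intro c hc d hd hcd
      rcases Finset.mem_insert.1 hc with rfl | hc' <;> rcases Finset.mem_insert.1 hd with rfl | hd'
      · exact absurd rfl hcd
      · exact (hcon d hd').le
      · rw [norm_sub_rev]; exact (hcon c hc').le
      · exact h2 c hc' d hd' hcd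
  have h3 := Nat.le_findGreatest (hP _ hP') hP'
  omega

/-! ### The constants `L_i` and `κ_i`, and the criterion for non-optimality. -/

section

variable {n τ m : ℕ}

theorem Seminorm.exists_le_mul_norm (p : Seminorm ℝ (EuclideanSpace ℝ (Fin n))) :
    ∃ B : ℝ, ∀ x, p x ≤ B * ‖x‖ := by
  refine ⟨∑ i, p (EuclideanSpace.basisFun (Fin n) ℝ i), fun x => ?_⟩
  have hx := (EuclideanSpace.basisFun (Fin n) ℝ).sum_repr x
  calc p x = p (∑ i, (EuclideanSpace.basisFun (Fin n) ℝ).repr x i •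
        EuclideanSpace.basisFun (Fin n) ℝ i) := by rw [hx]
    _ ≤ ∑ i, p ((EuclideanSpace.basisFun (Fin n) ℝ).repr x i •
        EuclideanSpace.basisFun (Fin n) ℝ i) :=
        Finset.le_sum_of_subadditive p (map_zero p).le (map_add_le_add p) _ _
    _ ≤ ∑ i, p (EuclideanSpace.basisFun (Fin n) ℝ i) * ‖x‖ := by
        refine Finset.sum_le_sum fun i _ => ?_
        rw [map_smul_eq_mul, mul_comm]
        refine mul_le_mul_of_nonneg_left ?_ (apply_nonneg _ _)
        simpa using PiLp.norm_apply_le x i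
    _ = _ := by rw [Finset.sum_mul]

/-- Makes the `sSup` in `lipConst` a genuine supremum rather than the default value 0. -/
theorem Seminorm.bddAbove_lipConst (p : Seminorm ℝ (EuclideanSpace ℝ (Fin n))) :
    BddAbove {r : ℝ | ∃ z₁ z₂ : EuclideanSpace ℝ (Fin n),
      z₁ ≠ z₂ ∧ r = (p z₁ - p z₂) / ‖z₁ - z₂‖} := by
  obtain ⟨B, hB⟩ := p.exists_le_mul_norm
  refine ⟨B, ?_⟩
  rintro _ ⟨z₁, z₂, hz, rfl⟩
  rw [div_le_iff₀ (norm_pos_iff.2 (sub_ne_zero.2 hz))]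
  have h1 := map_add_le_add p (z₁ - z₂) z₂
  rw [sub_add_cancel] at h1
  linarith [hB (z₁ - z₂)]

theorem Seminorm.le_lipConst_mul (p : Seminorm ℝ (EuclideanSpace ℝ (Fin n)))
    (x : EuclideanSpace ℝ (Fin n)) : p x ≤ lipConst p * ‖x‖ := by
  rcases eq_or_ne x 0 with rfl | hx
  · simp
  · rw [← div_le_iff₀ (norm_pos_iff.2 hx)]
    exact le_csSup p.bddAbove_lipConst ⟨x, 0, hx, by simp⟩

theorem lipConst_pos {p : Seminorm ℝ (EuclideanSpace ℝ (Fin n))} (hp : ∀ x, p x = 0 → x = 0)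
    {x : EuclideanSpace ℝ (Fin n)} (hx : x ≠ 0) : 0 < lipConst p := by
  have h1 : 0 < p x := lt_of_le_of_ne (apply_nonneg _ _) fun h => hx (hp x h.symm)
  exact pos_of_mul_pos_left (h1.trans_le (p.le_lipConst_mul x)) (norm_nonneg _)

theorem kappa_pos {p : Seminorm ℝ (EuclideanSpace ℝ (Fin n))} (hp : ∀ x, p x = 0 → x = 0)
    {x : EuclideanSpace ℝ (Fin n)} (hx : x ≠ 0) : 0 < kappa p x := by
  have hx' : ‖x‖⁻¹ • x ≠ 0 := smul_ne_zero (inv_ne_zero (norm_ne_zero_iff.2 hx)) hx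
  exact div_pos (lt_of_le_of_ne (apply_nonneg _ _) fun h => hx' (hp _ h.symm)) (lipConst_pos hp hx)

theorem kappa_le_one {p : Seminorm ℝ (EuclideanSpace ℝ (Fin n))} (hp : ∀ x, p x = 0 → x = 0)
    {x : EuclideanSpace ℝ (Fin n)} (hx : x ≠ 0) : kappa p x ≤ 1 := by
  rw [kappa, div_le_one (lipConst_pos hp hx)]
  have := p.le_lipConst_mul (‖x‖⁻¹ • x)
  rwa [norm_smul, norm_inv, norm_norm, inv_mul_cancel₀ (norm_ne_zero_iff.2 hx), mul_one] at this

theorem kappaMin_le (N : Fin τ → Seminorm ℝ (EuclideanSpace ℝ (Fin n)))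
    (x : EuclideanSpace ℝ (Fin n)) (i : Fin τ) : kappaMin N x ≤ kappa (N i) x :=
  ciInf_le (Set.finite_range _).bddBelow i

theorem kappaMin_pos (hτ : 0 < τ) {N : Fin τ → Seminorm ℝ (EuclideanSpace ℝ (Fin n))}
    (hN : ∀ i x, N i x = 0 → x = 0) {x : EuclideanSpace ℝ (Fin n)} (hx : x ≠ 0) :
    0 < kappaMin N x := by
  have : Nonempty (Fin τ) := ⟨⟨0, hτ⟩⟩
  obtain ⟨i, hi⟩ := exists_eq_ciInf_of_finite (f := fun i => kappa (N i) x)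
  rw [kappaMin, ← hi]
  exact kappa_pos (hN i) hx

/-- Every norm drops because `N i v ≤ L_i ‖v‖ < L_i κ_i = N i x̄₀`. -/
theorem not_isProgramMinimizer_of_norm_lt {N : Fin τ → Seminorm ℝ (EuclideanSpace ℝ (Fin n))}
    (hN : ∀ i x, N i x = 0 → x = 0) {C : ConvexCone ℝ (EuclideanSpace ℝ (Fin n))}
    {x₀ : EuclideanSpace ℝ (Fin n)} (hx₀ : x₀ ≠ 0) {A : Matrix (Fin m) (Fin n) ℝ}
    {v : EuclideanSpace ℝ (Fin n)} (hvC : v ∈ C) (hv : ‖v‖ < kappaMin N x₀)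
    (hAv : A.mulVec v.ofLp = A.mulVec (‖x₀‖⁻¹ • x₀).ofLp)
    {h : (Fin τ → ℝ) → ℝ} (hh : IsScalarization h) :
    ¬ IsProgramMinimizer N h A (C : Set (EuclideanSpace ℝ (Fin n))) x₀ x₀ := by
  rintro ⟨-, hmin⟩
  have hn : 0 < ‖x₀‖ := norm_pos_iff.2 hx₀
  have hfeas : ‖x₀‖ • v ∈ feasibleSet A (C : Set (EuclideanSpace ℝ (Fin n))) x₀ := by
    refine ⟨C.smul_mem hn hvC, ?_⟩
    rw [WithLp.ofLp_smul, Matrix.mulVec_smul, hAv, WithLp.ofLp_smul, Matrix.mulVec_smul, smul_smul,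
      mul_inv_cancel₀ hn.ne', one_smul]
  have hlt : ∀ i, N i (‖x₀‖ • v) < N i x₀ := by
    intro i
    have hL := lipConst_pos (hN i) hx₀
    have h1 : ‖v‖ < kappa (N i) x₀ := hv.trans_le (kappaMin_le N x₀ i)
    rw [kappa, lt_div_iff₀ hL, map_smul_eq_mul, norm_inv, norm_norm, inv_mul_eq_div,
      lt_div_iff₀ hn] at h1
    have h2 := (N i).le_lipConst_mul v
    rw [map_smul_eq_mul, norm_norm]
    nlinarith
  -- Strictness is used at the smaller point: raising its coordinate `i` to `N i x₀` strictly
  -- increases `h`, and monotonicity handles the other coordinates.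
  obtain ⟨i, hi⟩ := hh.exists_strict (fun i => N i (‖x₀‖ • v)) fun i => apply_nonneg _ _
  have h1 := hi _ (hlt i)
  have h2 := hh.monotoneOn (a := Function.update (fun i => N i (‖x₀‖ • v)) i (N i x₀))
    (b := fun i => N i x₀) ?_ (fun i => apply_nonneg _ _) ?_
  · exact absurd (hmin hfeas) (not_le.2 (h1.trans_le h2))
  · intro j
    rcases eq_or_ne j i with rfl | hj
    · simp
    · simp [hj]
  · intro j
    rcases eq_or_ne j i with rfl | hj
    · simp
    · simpa [hj] using (hlt j).le

end

/-! ### Gaussian width of a cone against its Gaussian distance. -/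

section

variable {n m : ℕ}

theorem integral_norm_sq_stdGaussian (n : ℕ) :
    ∫ x, ‖x‖ ^ 2 ∂(stdGaussian (EuclideanSpace ℝ (Fin n))) = n := by
  have hcoord : ∀ i : Fin n,
      ∫ x, (x i) ^ 2 ∂(stdGaussian (EuclideanSpace ℝ (Fin n))) = 1 := by
    intro i
    have h1 := variance_dual_stdGaussian
      (innerSL ℝ (EuclideanSpace.basisFun (Fin n) ℝ i) : StrongDual ℝ (EuclideanSpace ℝ (Fin n)))
    rw [variance_of_integral_eq_zero (by fun_prop) (integral_strongDual_stdGaussian _)] at h1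
    simpa [EuclideanSpace.inner_single_left] using h1
  have hint : ∀ i : Fin n,
      Integrable (fun x => (x i) ^ 2) (stdGaussian (EuclideanSpace ℝ (Fin n))) := by
    intro i
    refine MemLp.integrable_sq ?_
    refine (IsGaussian.memLp_two_id (μ := stdGaussian (EuclideanSpace ℝ (Fin n)))).mono
      (by fun_prop) (ae_of_all _ fun x => ?_)
    exact PiLp.norm_apply_le x i
  simp_rw [EuclideanSpace.real_norm_sq_eq]
  rw [integral_finsetSum _ fun i _ => hint i]
  simp [hcoord]

theorem LipschitzWith.sq_integral_le {f : EuclideanSpace ℝ (Fin n) → ℝ} (hf : LipschitzWith 1 f) :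
    (∫ x, f x ∂(stdGaussian (EuclideanSpace ℝ (Fin n)))) ^ 2
      ≤ ∫ x, f x ^ 2 ∂(stdGaussian (EuclideanSpace ℝ (Fin n))) := by
  have h := variance_nonneg f (stdGaussian (EuclideanSpace ℝ (Fin n)))
  rw [variance_eq_sub hf.memLp_two_stdGaussian] at h
  simpa using h

theorem integral_norm_stdGaussian_le (n : ℕ) :
    ∫ x, ‖x‖ ∂(stdGaussian (EuclideanSpace ℝ (Fin n))) ≤ √n := by
  have h := LipschitzWith.sq_integral_le (n := n) lipschitzWith_one_norm
  rw [integral_norm_sq_stdGaussian] at h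
  exact Real.le_sqrt_of_sq_le h

theorem gaussianDist_nonneg (M : Set (EuclideanSpace ℝ (Fin n))) : 0 ≤ gaussianDist M :=
  integral_nonneg fun _ => Metric.infDist_nonneg

theorem gaussianDist_le_sqrt {M : Set (EuclideanSpace ℝ (Fin n))} (h0 : 0 ∈ M) :
    gaussianDist M ≤ √n := by
  refine le_trans (integral_mono ?_ ?_ fun x => ?_) (integral_norm_stdGaussian_le n)
  · exact (Metric.lipschitz_infDist_pt M).integrable_stdGaussian
  · exact (lipschitzWith_one_norm (E := EuclideanSpace ℝ (Fin n))).integrable_stdGaussian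
  · simpa using Metric.infDist_le_dist_of_mem (x := x) h0

/-- The squared Gaussian width of a closed convex cone, bounded below by its Gaussian distance. -/
theorem sub_le_sq_integral_supportFun {C : ConvexCone ℝ (EuclideanSpace ℝ (Fin n))}
    (hC : IsClosed (C : Set (EuclideanSpace ℝ (Fin n)))) (h0 : (0 : EuclideanSpace ℝ (Fin n)) ∈ C) :
    n - gaussianDist (C : Set (EuclideanSpace ℝ (Fin n))) ^ 2 - 32 ≤
      (∫ x, supportFun ((C : Set (EuclideanSpace ℝ (Fin n))) ∩ Metric.closedBall 0 1) x
        ∂(stdGaussian (EuclideanSpace ℝ (Fin n)))) ^ 2 := by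
  set K := (C : Set (EuclideanSpace ℝ (Fin n))) ∩ Metric.closedBall 0 1
  have hK : LipschitzWith 1 (supportFun K) :=
    lipschitzWith_supportFun Set.inter_subset_right ⟨0, h0, by simp⟩
  have hD := Metric.lipschitz_infDist_pt (C : Set (EuclideanSpace ℝ (Fin n)))
  -- Each second moment exceeds the squared mean by at most 16, whence the loss of 32 from `E ‖x‖² =
  -- n`.
  have h1 := hK.integral_sq_le
  have h2 := hD.integral_sq_le
  have i1 := hK.memLp_two_stdGaussian.integrable_sq
  have i2 := hD.memLp_two_stdGaussian.integrable_sq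
  have h3 : ∫ x, ‖x‖ ^ 2 ∂(stdGaussian (EuclideanSpace ℝ (Fin n))) ≤
      ∫ x, (supportFun K x ^ 2 + Metric.infDist x (C : Set (EuclideanSpace ℝ (Fin n))) ^ 2)
        ∂(stdGaussian (EuclideanSpace ℝ (Fin n))) :=
    integral_mono
      (lipschitzWith_one_norm (E := EuclideanSpace ℝ (Fin n))).memLp_two_stdGaussian.integrable_sq
      (i1.add i2) fun x => ConvexCone.norm_sq_le hC h0 x
  rw [integral_norm_sq_stdGaussian, integral_add i1 i2] at h3
  rw [gaussianDist]
  linarith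

end

/-! ### Laws of `A x` and `Aᵀ z` for a Gaussian matrix. -/

/-- The characteristic function of the image at `t` is that of the source at `R t`, and the Gaussian
one depends only on the norm. -/
theorem stdGaussian_map_of_adjoint_norm {E F : Type*}
    [NormedAddCommGroup E] [InnerProductSpace ℝ E] [FiniteDimensional ℝ E]
    [MeasurableSpace E] [BorelSpace E]
    [NormedAddCommGroup F] [InnerProductSpace ℝ F] [FiniteDimensional ℝ F]
    [MeasurableSpace F] [BorelSpace F] {L : E → F} {R : F → E} (hL : Measurable L)
    (hadj : ∀ x t, inner ℝ (L x) t = inner ℝ x (R t)) (hR : ∀ t, ‖R t‖ = ‖t‖) :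
    (stdGaussian E).map L = stdGaussian F := by
  have : IsProbabilityMeasure ((stdGaussian E).map L) :=
    Measure.isProbabilityMeasure_map hL.aemeasurable
  refine Measure.ext_of_charFun (funext fun t => ?_)
  rw [charFun_stdGaussian, charFun_apply, integral_map hL.aemeasurable (by fun_prop)]
  simp_rw [hadj]
  rw [← charFun_apply, charFun_stdGaussian, hR]

section

variable {n m : ℕ} {Ω : Type*} [MeasurableSpace Ω] {μ : Measure Ω}
  {A : Ω → Matrix (Fin m) (Fin n) ℝ}

theorem hasLaw_toLp_entries (hAlaw : ∀ i j, HasLaw (fun ω => A ω i j) (gaussianReal 0 1) μ)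
    (hAindep : iIndepFun (fun (p : Fin m × Fin n) ω => A ω p.1 p.2) μ) :
    HasLaw (fun ω => WithLp.toLp 2 fun p : Fin m × Fin n => A ω p.1 p.2)
      (stdGaussian (EuclideanSpace ℝ (Fin m × Fin n))) μ := by
  have h1 := iIndepFun.hasLaw_pi (fun p : Fin m × Fin n => hAlaw p.1 p.2) hAindep
  have h2 : HasLaw (WithLp.toLp 2 : (Fin m × Fin n → ℝ) → EuclideanSpace ℝ (Fin m × Fin n))
      (stdGaussian (EuclideanSpace ℝ (Fin m × Fin n)))
      (Measure.pi fun _ => gaussianReal 0 1) := ⟨by fun_prop, map_pi_eq_stdGaussian⟩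
  exact h2.comp h1

theorem norm_toLp_mul (x : EuclideanSpace ℝ (Fin m)) (y : EuclideanSpace ℝ (Fin n)) :
    ‖(WithLp.toLp 2 fun p : Fin m × Fin n => x p.1 * y p.2 :
      EuclideanSpace ℝ (Fin m × Fin n))‖ = ‖x‖ * ‖y‖ := by
  rw [← sq_eq_sq₀ (norm_nonneg _) (by positivity), mul_pow]
  simp only [EuclideanSpace.real_norm_sq_eq, Fintype.sum_prod_type, Finset.sum_mul_sum, mul_pow]

/-- The map `X ↦ X x` has adjoint `t ↦ t ⊗ x`, an isometry because `‖x‖ = 1`. -/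
theorem hasLaw_toLp_mulVec (hAlaw : ∀ i j, HasLaw (fun ω => A ω i j) (gaussianReal 0 1) μ)
    (hAindep : iIndepFun (fun (p : Fin m × Fin n) ω => A ω p.1 p.2) μ)
    {x : EuclideanSpace ℝ (Fin n)} (hx : ‖x‖ = 1) :
    HasLaw (fun ω => WithLp.toLp 2 ((A ω).mulVec x.ofLp))
      (stdGaussian (EuclideanSpace ℝ (Fin m))) μ := by
  have hmeas : Measurable fun X : EuclideanSpace ℝ (Fin m × Fin n) =>
      (WithLp.toLp 2 fun i => ∑ j, X (i, j) * x j : EuclideanSpace ℝ (Fin m)) := by fun_prop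
  have h2 : HasLaw (fun X : EuclideanSpace ℝ (Fin m × Fin n) =>
      (WithLp.toLp 2 fun i => ∑ j, X (i, j) * x j : EuclideanSpace ℝ (Fin m)))
      (stdGaussian (EuclideanSpace ℝ (Fin m)))
      (stdGaussian (EuclideanSpace ℝ (Fin m × Fin n))) := by
    refine ⟨hmeas.aemeasurable, stdGaussian_map_of_adjoint_norm
      (R := fun t => WithLp.toLp 2 fun p => t p.1 * x p.2) hmeas (fun X t => ?_) fun t => ?_⟩
    · simp only [PiLp.inner_apply, Fintype.sum_prod_type, RCLike.inner_apply, conj_trivial,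
        Finset.mul_sum]
      refine Finset.sum_congr rfl fun i _ => Finset.sum_congr rfl fun j _ => by ring
    · rw [norm_toLp_mul, hx, mul_one]
  exact h2.comp (hasLaw_toLp_entries hAlaw hAindep)

theorem hasLaw_toLp_transpose_mulVec
    (hAlaw : ∀ i j, HasLaw (fun ω => A ω i j) (gaussianReal 0 1) μ)
    (hAindep : iIndepFun (fun (p : Fin m × Fin n) ω => A ω p.1 p.2) μ)
    {z : EuclideanSpace ℝ (Fin m)} (hz : ‖z‖ = 1) :
    HasLaw (fun ω => WithLp.toLp 2 ((A ω).transpose.mulVec z.ofLp))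
      (stdGaussian (EuclideanSpace ℝ (Fin n))) μ := by
  have h : iIndepFun (fun (p : Fin n × Fin m) ω => (A ω).transpose p.1 p.2) μ :=
    hAindep.precomp (g := Prod.swap) Prod.swap_injective
  exact hasLaw_toLp_mulVec (A := fun ω => (A ω).transpose) (fun i j => hAlaw j i) h hz

theorem inner_toLp_transpose_mulVec (B : Matrix (Fin m) (Fin n) ℝ) (z : EuclideanSpace ℝ (Fin m))
    (v : EuclideanSpace ℝ (Fin n)) :
    inner ℝ (Matrix.toEuclideanLin B.transpose z) v = inner ℝ z (Matrix.toEuclideanLin B v) := by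
  simp only [EuclideanSpace.inner_eq_star_dotProduct, star_trivial, Matrix.ofLp_toLpLin,
    Matrix.toLin'_apply]
  rw [Matrix.mulVec_transpose, dotProduct_comm, ← Matrix.dotProduct_mulVec, dotProduct_comm]

theorem HasLaw.real_measure_setOf {E : Type*} [MeasurableSpace E] {ν : Measure E} {Y : Ω → E}
    (hY : HasLaw Y ν μ) {s : Set E} (hs : MeasurableSet s) :
    μ.real {ω | Y ω ∈ s} = ν.real s := by
  rw [← hY.map_eq, measureReal_def, measureReal_def, Measure.map_apply_of_aemeasurable hY.1 hs]
  rfl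

end

/-- Taking the complement of a measurable hull spares any measurability proof for the failure set.
-/
theorem exists_measurableSet_of_measureReal_le {Ω : Type*} [MeasurableSpace Ω] {μ : Measure Ω}
    [IsProbabilityMeasure μ] {B : Set Ω} {c : ℝ} (hB : μ.real B ≤ c) :
    ∃ E : Set Ω, MeasurableSet E ∧ 1 - c ≤ μ.real E ∧ ∀ ω ∈ E, ω ∉ B := by
  refine ⟨(toMeasurable μ B)ᶜ, (measurableSet_toMeasurable μ B).compl, ?_,
    fun ω hω hB => hω (subset_toMeasurable μ B hB)⟩
  rw [measureReal_compl (measurableSet_toMeasurable μ B), probReal_univ, measureReal_def,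
    measure_toMeasurable, ← measureReal_def]
  linarith

/-! ### Failure probabilities and their deterministic consequence. -/

section

variable {n m : ℕ} {Ω : Type*} [MeasurableSpace Ω] {μ : Measure Ω}
  {A : Ω → Matrix (Fin m) (Fin n) ℝ}

theorem measure_sqrt_add_le_norm_mulVec
    (hAlaw : ∀ i j, HasLaw (fun ω => A ω i j) (gaussianReal 0 1) μ)
    (hAindep : iIndepFun (fun (p : Fin m × Fin n) ω => A ω p.1 p.2) μ)
    {x : EuclideanSpace ℝ (Fin n)} (hx : ‖x‖ = 1) {s : ℝ} (hs : 0 ≤ s) :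
    μ.real {ω | √m + s ≤ ‖Matrix.toEuclideanLin (A ω) x‖} ≤ Real.exp (-s ^ 2 / 5) := by
  have h1 := (lipschitzWith_one_norm (E := EuclideanSpace ℝ (Fin m))).measure_add_le hs
  have hms : MeasurableSet {y : EuclideanSpace ℝ (Fin m) | √m + s ≤ ‖y‖} :=
    measurableSet_le measurable_const measurable_norm
  have h2 := HasLaw.real_measure_setOf (hasLaw_toLp_mulVec hAlaw hAindep hx) hms
  refine (le_of_eq_of_le h2 (measureReal_mono fun y hy => ?_)).trans h1
  exact (add_le_add_left (integral_norm_stdGaussian_le m) s).trans hy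

/-- Union bound over the net; the factor 2 counts the two one-sided tails. -/
theorem measure_exists_supportFun_far
    (hAlaw : ∀ i j, HasLaw (fun ω => A ω i j) (gaussianReal 0 1) μ)
    (hAindep : iIndepFun (fun (p : Fin m × Fin n) ω => A ω p.1 p.2) μ)
    [IsProbabilityMeasure μ]
    {K : Set (EuclideanSpace ℝ (Fin n))} (hK : K ⊆ Metric.closedBall 0 1) (h0 : K.Nonempty)
    {t : Finset (EuclideanSpace ℝ (Fin m))} (ht : ∀ z ∈ t, ‖z‖ = 1) {s : ℝ} (hs : 0 ≤ s) :
    μ.real {ω | ∃ z ∈ t,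
      supportFun K (Matrix.toEuclideanLin (A ω).transpose z) ≤
        (∫ x, supportFun K x ∂(stdGaussian (EuclideanSpace ℝ (Fin n)))) - s ∨
      (∫ x, supportFun K x ∂(stdGaussian (EuclideanSpace ℝ (Fin n)))) + s ≤
        supportFun K (Matrix.toEuclideanLin (A ω).transpose z)}
      ≤ t.card * (2 * Real.exp (-s ^ 2 / 5)) := by
  have hL := lipschitzWith_supportFun hK h0
  set W := ∫ x, supportFun K x ∂(stdGaussian (EuclideanSpace ℝ (Fin n)))
  have hsub : {ω | ∃ z ∈ t,
      supportFun K (Matrix.toEuclideanLin (A ω).transpose z) ≤ W - s ∨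
      W + s ≤ supportFun K (Matrix.toEuclideanLin (A ω).transpose z)} ⊆
      ⋃ z ∈ t, ({ω | Matrix.toEuclideanLin (A ω).transpose z ∈ {x | supportFun K x ≤ W - s}} ∪
        {ω | Matrix.toEuclideanLin (A ω).transpose z ∈ {x | W + s ≤ supportFun K x}}) := by
    rintro ω ⟨z, hz, h⟩
    exact Set.mem_biUnion hz h
  refine (measureReal_mono hsub (measure_ne_top _ _)).trans ((measureReal_biUnion_finset_le _ _).trans ?_)
  rw [← nsmul_eq_mul]
  refine Finset.sum_le_card_nsmul _ _ _ fun z hz => ?_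
  have hlaw := hasLaw_toLp_transpose_mulVec hAlaw hAindep (ht z hz)
  have e1 := HasLaw.real_measure_setOf hlaw
    (measurableSet_le hL.continuous.measurable measurable_const :
      MeasurableSet {x | supportFun K x ≤ W - s})
  have e2 := HasLaw.real_measure_setOf hlaw
    (measurableSet_le measurable_const hL.continuous.measurable :
      MeasurableSet {x | W + s ≤ supportFun K x})
  refine (measureReal_union_le _ _).trans ?_
  rw [two_mul]
  exact add_le_add (e1.trans_le (hL.measure_le_sub hs)) (e2.trans_le (hL.measure_add_le hs))

end

/-- Deterministic part: the data of a failure-free realization of the matrix yield a feasible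
point of small norm. -/
theorem exists_mem_cone_mulVec_eq {n m : ℕ} {C : ConvexCone ℝ (EuclideanSpace ℝ (Fin n))}
    (hC : IsClosed (C : Set (EuclideanSpace ℝ (Fin n))))
    (h0 : (0 : EuclideanSpace ℝ (Fin n)) ∈ C) (B : Matrix (Fin m) (Fin n) ℝ)
    {t : Finset (EuclideanSpace ℝ (Fin m))}
    (ht : ∀ z : EuclideanSpace ℝ (Fin m), ‖z‖ = 1 → ∃ w ∈ t, ‖z - w‖ ≤ 1 / 8) {W r : ℝ}
    (hW : 0 ≤ W) (hr : 0 < r)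
    (hlow : ∀ w ∈ t, W - 3 / 5 * W ≤ supportFun ((C : Set _) ∩ Metric.closedBall 0 1)
      (Matrix.toEuclideanLin B.transpose w))
    (hupp : ∀ w ∈ t, supportFun ((C : Set _) ∩ Metric.closedBall 0 1)
      (Matrix.toEuclideanLin B.transpose w) ≤ W + 3 / 5 * W)
    {x : EuclideanSpace ℝ (Fin n)} (hx : ‖Matrix.toEuclideanLin B x‖ ≤ r * (6 / 35 * W)) :
    ∃ v ∈ C, ‖v‖ ≤ r ∧ B.mulVec v.ofLp = B.mulVec x.ofLp := by
  have hK : (C : Set (EuclideanSpace ℝ (Fin n))) ∩ Metric.closedBall 0 1 ⊆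
    Metric.closedBall 0 1 := Set.inter_subset_right
  have hne : ((C : Set (EuclideanSpace ℝ (Fin n))) ∩ Metric.closedBall 0 1).Nonempty :=
    ⟨0, h0, by simp⟩
  have hcomp : IsCompact ((C : Set (EuclideanSpace ℝ (Fin n))) ∩ Metric.closedBall 0 1) :=
    (isCompact_closedBall 0 1).inter_left hC
  -- The net bounds `a = 2W/5` and `b = 8W/5` give `σ = a - b/7 = 6W/35`.
  obtain ⟨v, hv, hvx⟩ := exists_mem_map_smul_eq hcomp (C.convex.inter (convex_closedBall 0 1)) hne
    (Matrix.toEuclideanLin B) (Matrix.toEuclideanLin B.transpose) (inner_toLp_transpose_mulVec B)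
    hr.le (σ := 6 / 35 * W) (fun z hz => by
      have := sub_div_le_supportFun_of_net hK hne (Matrix.toEuclideanLin B.transpose) ht
        (by positivity) hlow hupp hz
      linarith) hx
  refine ⟨r • v, C.smul_mem hr hv.1, ?_, congrArg WithLp.ofLp hvx⟩
  rw [norm_smul, Real.norm_eq_abs, abs_of_pos hr]
  exact mul_le_of_le_one_right hr.le (by simpa using hv.2)

/-! ### Numerical bounds and assembly. -/

/-- A nontrivial probability bound forces the exponent to be large, because `36 / 16 = 9 / 4` and
`e^(9/4) ≤ 10`; additive constants can then be absorbed. -/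
theorem lt_of_ten_mul_exp_lt_one {a : ℝ} (h : 10 * Real.exp (-a / 16) < 1) : 36 < a := by
  by_contra hcon
  push Not at hcon
  have h1 : Real.exp (-(9 / 4)) ≤ Real.exp (-a / 16) := Real.exp_le_exp.2 (by linarith)
  have h2 : Real.exp (9 / 4) ≤ 10 := by
    have h3 : Real.exp (9 / 4) ^ 4 = Real.exp 1 ^ 9 := by
      rw [← Real.exp_nat_mul, ← Real.exp_nat_mul]; norm_num
    have h4 : Real.exp 1 ^ 9 ≤ (10 : ℝ) ^ 4 := by
      calc Real.exp 1 ^ 9 ≤ (2.7182818286 : ℝ) ^ 9 := by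
            gcongr; exact Real.exp_one_lt_d9.le
        _ ≤ _ := by norm_num
    rw [← h3] at h4
    exact le_of_pow_le_pow_left₀ (by norm_num) (by norm_num) h4
  rw [Real.exp_neg] at h1
  have h5 := inv_anti₀ (Real.exp_pos _) h2
  linarith

theorem seventeen_pow_le_exp (m : ℕ) : (17 : ℝ) ^ m ≤ Real.exp (3 * m) := by
  have h : (17 : ℝ) ≤ Real.exp 3 := by
    have h1 : Real.exp 3 = Real.exp 1 ^ 3 := by rw [← Real.exp_nat_mul]; norm_num
    rw [h1]
    calc (17 : ℝ) ≤ 2.7182818283 ^ 3 := by norm_num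
      _ ≤ _ := by gcongr; exact Real.exp_one_gt_d9.le
  calc (17 : ℝ) ^ m ≤ Real.exp 3 ^ m := by gcongr
    _ = _ := by rw [← Real.exp_nat_mul]; congr 1; ring

theorem mainTheorem2 {m n τ : ℕ} (hτ : 0 < τ)
    {Ω : Type*} [MeasurableSpace Ω] (μ : Measure Ω) [IsProbabilityMeasure μ]
    (A : Ω → Matrix (Fin m) (Fin n) ℝ)
    (hAlaw : ∀ i j, HasLaw (fun ω => A ω i j) (gaussianReal 0 1) μ)
    (hAindep : iIndepFun (fun (p : Fin m × Fin n) ω => A ω p.1 p.2) μ)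
    (N : Fin τ → Seminorm ℝ (EuclideanSpace ℝ (Fin n)))
    (hN : ∀ i x, N i x = 0 → x = 0)
    (C : ConvexCone ℝ (EuclideanSpace ℝ (Fin n)))
    (hC : IsClosed (C : Set (EuclideanSpace ℝ (Fin n))))
    (x₀ : EuclideanSpace ℝ (Fin n)) (hx₀C : x₀ ∈ C) (hx₀ : x₀ ≠ 0)
    (hm : (m : ℝ) ≤ mLow N (C : Set (EuclideanSpace ℝ (Fin n))) x₀) :
    ∃ E : Set Ω, MeasurableSet E ∧
      1 - 10 * Real.exp (-(min (mLow N (C : Set (EuclideanSpace ℝ (Fin n))) x₀)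
          ((1 - normalizedGaussianDist (C : Set (EuclideanSpace ℝ (Fin n)))) ^ 2 * n)) / 16)
        ≤ μ.real E ∧
      ∀ ω ∈ E, ∀ h : (Fin τ → ℝ) → ℝ, IsScalarization h →
        ¬ IsProgramMinimizer N h (A ω) (C : Set (EuclideanSpace ℝ (Fin n))) x₀ x₀ := by
  set D := normalizedGaussianDist (C : Set (EuclideanSpace ℝ (Fin n))) with hD
  set M := mLow N (C : Set (EuclideanSpace ℝ (Fin n))) x₀ with hM
  set κ := kappaMin N x₀ with hκ
  by_cases hvac : 1 - 10 * Real.exp (-(min M ((1 - D) ^ 2 * n)) / 16) ≤ 0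
  · exact ⟨∅, MeasurableSet.empty, by simpa using hvac, by simp⟩
  push Not at hvac
  have hM36 : 36 < M := (lt_of_ten_mul_exp_lt_one (a := min M ((1 - D) ^ 2 * n)) (by linarith)).trans_le (min_le_left _ _)
  have hn : 0 < (n : ℝ) := by
    rcases Nat.eq_zero_or_pos n with rfl | h
    · exact absurd (Subsingleton.elim x₀ 0) hx₀
    · exact_mod_cast h
  have h0 := ConvexCone.zero_mem_of_isClosed hC hx₀C
  have hκ0 : 0 < κ := kappaMin_pos hτ hN hx₀
  have hκ1 : κ ≤ 1 := (kappaMin_le N x₀ ⟨0, hτ⟩).trans (kappa_le_one (hN _) hx₀)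
  have hDn : gaussianDist (C : Set (EuclideanSpace ℝ (Fin n))) = D * √n := by
    rw [hD, normalizedGaussianDist, div_mul_cancel₀ _ (Real.sqrt_pos.2 hn).ne']
  have hD0 : 0 ≤ D := div_nonneg (gaussianDist_nonneg _) (Real.sqrt_nonneg _)
  have hD1 : D ≤ 1 := div_le_one_of_le₀ (gaussianDist_le_sqrt h0) (Real.sqrt_nonneg _)
  set q := (1 - D) * n with hq
  have hMq : 100 * M = q * κ ^ 2 := by rw [hM, mLow, hq]; ring
  have hq0 : 0 ≤ q := mul_nonneg (by linarith) hn.le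
  have hκsq : κ ^ 2 ≤ 1 := pow_le_one₀ hκ0.le hκ1
  -- Since `M > 36`, this gives `q > 3600`, so the loss of 32 is below `q / 100`.
  have hqM : 100 * M ≤ q := by nlinarith
  set K := (C : Set (EuclideanSpace ℝ (Fin n))) ∩ Metric.closedBall 0 1 with hKdef
  have hK : K ⊆ Metric.closedBall 0 1 := Set.inter_subset_right
  have hne : K.Nonempty := ⟨0, h0, by simp⟩
  set W := ∫ x, supportFun K x ∂(stdGaussian (EuclideanSpace ℝ (Fin n))) with hWdef
  have hW0 : 0 ≤ W := integral_nonneg fun x => by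
    simpa using inner_le_supportFun hK x (v := 0) ⟨h0, by simp⟩
  have hWq : 99 / 100 * q ≤ W ^ 2 := by
    have h1 := sub_le_sq_integral_supportFun hC h0
    rw [hDn, mul_pow, Real.sq_sqrt hn.le] at h1
    have h2 : q ≤ n - D ^ 2 * n := by
      have : n - D ^ 2 * n = q * (1 + D) := by rw [hq]; ring
      rw [this]; nlinarith
    linarith
  have hW : 99 / 100 * √q ≤ W := by
    refine le_of_pow_le_pow_left₀ two_ne_zero hW0 ?_
    rw [mul_pow, Real.sq_sqrt hq0]
    linarith
  have hsM : √M = κ * √q / 10 := by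
    rw [Real.sqrt_eq_iff_mul_self_eq (by linarith) (by positivity)]
    have := Real.sq_sqrt hq0
    nlinarith
  set x := ‖x₀‖⁻¹ • x₀ with hx
  have hxn : ‖x‖ = 1 := by
    rw [hx, norm_smul, norm_inv, norm_norm, inv_mul_cancel₀ (norm_ne_zero_iff.2 hx₀)]
  obtain ⟨t, ht1, htcard, htnet⟩ := exists_net_sphere (EuclideanSpace ℝ (Fin m))
  rw [finrank_euclideanSpace_fin] at htcard
  have hB1 := measure_exists_supportFun_far hAlaw hAindep hK hne ht1
    (s := 3 / 5 * W) (by positivity)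
  -- The factor `14/25` satisfies `(14/25)² / 5 ≥ 1/16`, yet keeps `√m + 14/25 √M ≤ 1.56 √M`.
  have hB2 := measure_sqrt_add_le_norm_mulVec hAlaw hAindep hxn
    (s := 14 / 25 * √M) (by positivity)
  have hb1 : (t.card : ℝ) * (2 * Real.exp (-(3 / 5 * W) ^ 2 / 5)) ≤ 2 * Real.exp (-M / 16) := by
    calc (t.card : ℝ) * (2 * Real.exp (-(3 / 5 * W) ^ 2 / 5))
        ≤ Real.exp (3 * m) * (2 * Real.exp (-(3 / 5 * W) ^ 2 / 5)) := by
          gcongr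
          exact (show (t.card : ℝ) ≤ 17 ^ m by exact_mod_cast htcard).trans
            (seventeen_pow_le_exp m)
      _ = 2 * Real.exp (3 * m + -(3 / 5 * W) ^ 2 / 5) := by rw [Real.exp_add]; ring
      _ ≤ _ := by
          gcongr
          -- Here `m ≤ M` and `W² ≥ 99 M`, so the Gaussian tail outweighs the net cardinality
          -- `e^(3m)`.
          nlinarith
  have hb2 : Real.exp (-(14 / 25 * √M) ^ 2 / 5) ≤ Real.exp (-M / 16) := by
    rw [Real.exp_le_exp, mul_pow, Real.sq_sqrt (by linarith)]
    linarith
  have hexp : Real.exp (-M / 16) ≤ Real.exp (-(min M ((1 - D) ^ 2 * n)) / 16) := by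
    rw [Real.exp_le_exp]
    have := min_le_left M ((1 - D) ^ 2 * n)
    gcongr
  have hpos := Real.exp_pos (-M / 16)
  obtain ⟨E, hE, hEμ, hEB⟩ := exists_measurableSet_of_measureReal_le
    (((measureReal_union_le _ _).trans (add_le_add hB1 hB2)).trans
      ((add_le_add hb1 hb2).trans
        (by linarith : 2 * Real.exp (-M / 16) + Real.exp (-M / 16) ≤ 10 * Real.exp (-(min M ((1 - D) ^ 2 * n)) / 16))))
  refine ⟨E, hE, hEμ, fun ω hω h hh => ?_⟩
  have hgood := hEB ω hω
  simp only [Set.mem_union, Set.mem_ofPred_eq, not_or, not_exists, not_and, not_le] at hgood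
  obtain ⟨hg1, hg2⟩ := hgood
  -- As `√M = κ √q / 10`, the left side is at most `0.156 κ √q`, while the right is at least `0.161
  -- κ √q`. The factor `19/20` leaves room for `‖v‖ < κ`.
  have hnorm : ‖Matrix.toEuclideanLin (A ω) x‖ ≤ 19 / 20 * κ * (6 / 35 * W) := by
    have h1 : √(m : ℝ) ≤ √M := Real.sqrt_le_sqrt hm
    have h2 : κ * (99 / 100 * √q) ≤ κ * W := by gcongr
    have h3 : 0 ≤ κ * √q := by positivity
    linarith
  obtain ⟨v, hvC, hvr, hAv⟩ := exists_mem_cone_mulVec_eq hC h0 (A ω) htnet hW0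
    (r := 19 / 20 * κ) (by positivity) (fun w hw => (hg1 w hw).1.le)
    (fun w hw => (hg1 w hw).2.le) hnorm
  exact not_isProgramMinimizer_of_norm_lt hN hx₀ hvC (hvr.trans_lt (by linarith)) hAv hh
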